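/- Let $n\ge 1$ be an integer and $a>0$. Let $X_1,X_2$ be independent random points, each uniformly distributed in a ball of radius $a$ in $\mathbb R^n$ (with the Euclidean norm), and let $D=|X_1-X_2|$. Put $$C=\frac{n\,\Gamma(n+1)}{\Gamma\left(\frac n2+\frac12\right)},\qquad C'=\sqrt{\pi}\,2^{-n}C.$$ (i) $D/(2a)$ has a density on $(0,1)$ given by $$f_n(\lambda)=\frac{2n\,\Gamma(n+1)\,\lambda^{n-1}}{\Gamma\left(\frac n2+\frac12\right)^2}\int_\lambda^1(1-z^2)^{(n-1)/2}\,dz .$$ (ii) For $s\in\mathbb C$, the variable $D^s$ is integrable if and only if $\operatorname{Re}s>-n$, and in that case $$\mathbb E\,(D/2a)^s=\frac{n\,\Gamma(n+1)}{\Gamma\left(\frac n2+\frac12\right)}\cdot\frac{\Gamma\left(\frac n2+\frac s2+\frac12\right)}{(n+s)\,\Gamma\left(n+\frac s2+1\right)},$$ $$\mathbb E\,D^s=C(2a)^s\frac{\Gamma(s+n)\,\Gamma\left(\frac s2+\frac n2+\frac12\right)}{\Gamma(s+n+1)\,\Gamma\left(\frac s2+n+1\right)}=C'a^s\frac{\Gamma(s+n)}{\Gamma\left(\frac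 s2+\frac n2+1\right)\Gamma\left(\frac s2+n+1\right)} .$$ (iii) Let $B_{\alpha,\beta}$ denote a random variable with the Beta distribution with parameters $\alpha,\beta$. If $B_{n,1}$ and $B_{(n+1)/2,(n+1)/2}$ are independent, then $D$ has the same distribution as $2a\,B_{n,1}\,B_{(n+1)/2,(n+1)/2}^{1/2}$. Likewise, if $U$ is uniform on $(0,1)$ and independent of $B_{(n+1)/2,(n+1)/2}$, then $D$ has the same distribution as $2a\,U^{1/n}\,B_{(n+1)/2,(n+1)/2}^{1/2}$. (iv) If $n=2$, then $\mathbb E D=\frac{128}{45\pi}a$. If $a=\frac12$, then: for $n=1$, $\mathbb E D=\frac13$ and $\mathbb E D^2=\frac16$; for $n=2$, $\mathbb E D=\frac{64}{45\pi}$ and $\mathbb E D^2=\frac14$; for $n=3$, $\mathbb E D=\frac{18}{35}$ and $\mathbb E D^2=\frac{3}{10}$. For all $n$ and $a$, $\mathbb E D^2=\frac{2a^2n}{n+2}$. -/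

import Mathlib

open MeasureTheory ProbabilityTheory

noncomputable section

/-- The normalising constant `C = n Γ(n+1) / Γ(n/2 + 1/2)`. -/
def ballDistConst (n : ℕ) : ℝ :=
  n * Real.Gamma (n + 1) / Real.Gamma ((n : ℝ) / 2 + 1 / 2)

/-- The function
`f_n(l) = 2 n Γ(n+1) l^(n-1) / Γ(n/2 + 1/2)^2 * ∫_l^1 (1 - z^2)^((n-1)/2) dz` (for `0 < l < 1`). -/
def ballDistDensity (n : ℕ) (l : ℝ) : ℝ :=
  2 * n * Real.Gamma (n + 1) * l ^ ((n : ℝ) - 1) / Real.Gamma ((n : ℝ) / 2 + 1 / 2) ^ 2 *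
    ∫ z in l..1, (1 - z ^ 2) ^ (((n : ℝ) - 1) / 2)

end

/-!
Writing `X₁ = c + a (w + u)` and `X₂ = c + a (w - u)`, the normalised distance `D / (2a)` becomes
`‖u‖`, and the condition that both points lie in the ball says that `w` lies in the lens
`B(u, 1) ∩ B(-u, 1)`. Slicing the lens orthogonally to `u` gives its volume as a multiple of
`∫_‖u‖^1 (1 - t ^ 2) ^ ((n - 1) / 2) dt`, and polar coordinates in `u` turn this into a density on
`(0, 1)` proportional to `r ^ (n - 1) * ∫_r^1 (1 - t ^ 2) ^ ((n - 1) / 2) dt`. The product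
`B₁ * √B₂` of independent Beta variables of parameters `(n, 1)` and `((n + 1) / 2, (n + 1) / 2)` has
a density proportional to the same function. Proportional probability measures are equal, so the
two laws agree and no geometric constant has to be computed. The moments of `D / (2a)` are therefore
products of Beta moments, and Legendre's duplication formula gives their last form.
-/

section Measures

variable {X Y : Type*} [MeasurableSpace X] [MeasurableSpace Y]

theorem eq_of_eq_smul_measure {μ ν ρ : Measure X} [IsProbabilityMeasure μ] [IsProbabilityMeasure ν]
    {a b : ENNReal} (hμ : μ = a • ρ) (hν : ν = b • ρ) : μ = ν := by
  have h {κ : Measure X} [IsProbabilityMeasure κ] {k : ENNReal} (hκ : κ = k • ρ) :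
      k = (ρ Set.univ)⁻¹ := by
    refine ENNReal.eq_inv_of_mul_eq_one_left ?_
    rw [← smul_eq_mul, ← Measure.smul_apply, ← hκ, measure_univ]
  rw [hμ, hν, h hμ, h hν]

theorem map_fst_restrict_prod (μ : Measure X) (ν : Measure Y) [SFinite ν] {s : Set (X × Y)}
    (hs : MeasurableSet s) :
    ((μ.prod ν).restrict s).map Prod.fst = μ.withDensity fun x => ν (Prod.mk x ⁻¹' s) := by
  ext t ht
  rw [Measure.map_apply measurable_fst ht, Measure.restrict_apply (measurable_fst ht),
    Measure.prod_apply ((measurable_fst ht).inter hs), withDensity_apply _ ht,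
    ← lintegral_indicator ht]
  congr 1 with x
  by_cases hx : x ∈ t <;> simp [hx, Set.preimage_inter, Set.preimage_preimage]

theorem map_withDensity_comp (μ : Measure X) {f : X → Y} {h : Y → ENNReal} (hf : Measurable f)
    (hh : Measurable h) : (μ.withDensity (h ∘ f)).map f = (μ.map f).withDensity h := by
  ext t ht
  rw [Measure.map_apply hf ht, withDensity_apply _ (hf ht), withDensity_apply _ ht,
    setLIntegral_map ht hh hf]
  rfl

theorem measurable_setLIntegral_Ioc (h : ℝ → ENNReal) (b : ℝ) :
    Measurable fun r => ∫⁻ t in Set.Ioc r b, h t :=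
  Antitone.measurable fun _ _ hxy => lintegral_mono_set (Set.Ioc_subset_Ioc_left hxy)

theorem lintegral_comp_abs (f : ℝ → ENNReal) :
    ∫⁻ t : ℝ, f |t| = 2 * ∫⁻ t in Set.Ioi (0 : ℝ), f t := by
  have hpos : ∫⁻ t in Set.Ioi (0 : ℝ), f |t| = ∫⁻ t in Set.Ioi (0 : ℝ), f t :=
    setLIntegral_congr_fun measurableSet_Ioi fun t ht => by rw [abs_of_pos ht]
  have hneg : ∫⁻ t in Set.Iic (0 : ℝ), f |t| = ∫⁻ t in Set.Ioi (0 : ℝ), f t := by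
    rw [← hpos, setLIntegral_congr Iio_ae_eq_Iic.symm,
      ← (Measure.measurePreserving_neg (volume : Measure ℝ)).setLIntegral_comp_preimage_emb
      (MeasurableEquiv.neg ℝ).measurableEmbedding]
    simp only [abs_neg, Set.neg_preimage, Set.neg_Iio, neg_zero]
  rw [← lintegral_add_compl _ (measurableSet_Iic (a := (0 : ℝ))), hneg, Set.compl_Iic, hpos,
    two_mul]

theorem setLIntegral_Ioi_comp_add_right (f : ℝ → ENNReal) (r : ℝ) :
    ∫⁻ t in Set.Ioi (0 : ℝ), f (t + r) = ∫⁻ t in Set.Ioi r, f t := by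
  rw [← (measurePreserving_add_right (volume : Measure ℝ) r).setLIntegral_comp_preimage_emb
    (MeasurableEquiv.addRight r).measurableEmbedding f (Set.Ioi r)]
  simp

end Measures

section Haar

variable {V : Type*} [NormedAddCommGroup V] [NormedSpace ℝ V] [FiniteDimensional ℝ V]
  [MeasurableSpace V] [BorelSpace V]

theorem exists_eq_smul_map_affine (μ : Measure V) [μ.IsAddHaarMeasure] (e : V ≃L[ℝ] V) (v : V) :
    ∃ k : NNReal, μ = k • μ.map fun x => v + e x := by
  have hmap : μ.map (fun x => v + e x) = μ.map e := by
    rw [← map_add_left_eq_self (μ.map e) v, Measure.map_map (by fun_prop) (by fun_prop)]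
    rfl
  rw [hmap]
  exact ⟨_, Measure.isAddLeftInvariant_eq_smul μ (μ.map e)⟩

theorem map_norm_addHaar [Nontrivial V] (μ : Measure V) [μ.IsAddHaarMeasure] :
    μ.map norm = μ.toSphere Set.univ • (volume.restrict (Set.Ioi 0)).withDensity
      fun r => ENNReal.ofReal (r ^ (Module.finrank ℝ V - 1)) := by
  set σ := Measure.volumeIoiPow (Module.finrank ℝ V - 1)
  have hradial : σ.map (↑) = (volume.restrict (Set.Ioi 0)).withDensity
      fun r : ℝ => ENNReal.ofReal (r ^ (Module.finrank ℝ V - 1)) := by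
    rw [← map_comap_subtype_coe measurableSet_Ioi, ← map_withDensity_comp _ (by fun_prop)
      (by fun_prop)]
    rfl
  calc μ.map norm
    _ = ((μ.comap (Subtype.val : ({0}ᶜ : Set V) → V)).map Subtype.val).map norm := by
        rw [map_comap_subtype_coe (measurableSet_singleton _).compl, restrict_compl_singleton]
    _ = (((μ.comap Subtype.val).map (homeomorphUnitSphereProd V)).map Prod.snd).map
        Subtype.val := by
        have hmeas := (homeomorphUnitSphereProd V).measurable
        rw [Measure.map_map measurable_norm measurable_subtype_coe,
          Measure.map_map measurable_snd hmeas,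
          Measure.map_map measurable_subtype_coe (measurable_snd.comp hmeas)]
        congr 1 with x
        exact (homeomorphUnitSphereProd_apply_snd_coe V x).symm
    _ = _ := by
        rw [μ.measurePreserving_homeomorphUnitSphereProd.map_eq, Measure.map_snd_prod,
          Measure.map_smul, hradial]

end Haar

section CapMeasure

/-- The measure on `(0, 1)` with density `r ^ (α - 1) * ∫ t in r..1, (1 - t ^ 2) ^ (δ - 1)`: it is
the unnormalised common law of the normalised distance and of the product of Beta variables, and
its density is kept in `ℝ≥0∞` so that no integrability has to be checked. -/
noncomputable def capMeasure (α δ : ℝ) : Measure ℝ :=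
  (volume.restrict (Set.Ioo 0 1)).withDensity fun r =>
    ENNReal.ofReal (r ^ (α - 1)) * ∫⁻ t in Set.Ioc r 1, ENNReal.ofReal ((1 - t ^ 2) ^ (δ - 1))

theorem capMeasure_eq_withDensity_restrict_Ioi (α δ : ℝ) :
    capMeasure α δ = (volume.restrict (Set.Ioi 0)).withDensity fun r =>
      ENNReal.ofReal (r ^ (α - 1)) *
        ∫⁻ t in Set.Ioc r 1, ENNReal.ofReal ((1 - t ^ 2) ^ (δ - 1)) := by
  rw [capMeasure, ← withDensity_indicator measurableSet_Ioo,
    ← withDensity_indicator measurableSet_Ioi]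
  congr 1 with r
  by_cases h1 : r < 1
  · simp [Set.indicator_apply, h1]
  · simp [Set.indicator_apply, h1, Set.Ioc_eq_empty]

end CapMeasure

section Lens

variable {E F : Type*} [NormedAddCommGroup E] [InnerProductSpace ℝ E] [FiniteDimensional ℝ E]
  [NormedAddCommGroup F] [InnerProductSpace ℝ F] [FiniteDimensional ℝ F]

theorem exists_linearIsometryEquiv_prod_apply_eq
    (hdim : Module.finrank ℝ E = Module.finrank ℝ F + 1) (u : E) :
    ∃ φ : WithLp 2 (ℝ × F) ≃ₗᵢ[ℝ] E, φ (WithLp.toLp 2 (‖u‖, 0)) = u := by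
  have h : Module.finrank ℝ (WithLp 2 (ℝ × F)) = Module.finrank ℝ E := by
    rw [(WithLp.linearEquiv 2 ℝ (ℝ × F)).finrank_eq, Module.finrank_prod, hdim,
      Module.finrank_self, add_comm]
  let e : WithLp 2 (ℝ × F) ≃ₗᵢ[ℝ] E :=
    (stdOrthonormalBasis ℝ (WithLp 2 (ℝ × F))).equiv (stdOrthonormalBasis ℝ E) (finCongr h)
  have hn : ‖e (WithLp.toLp 2 (‖u‖, (0 : F)))‖ = ‖u‖ := by
    rw [e.norm_map, ← sq_eq_sq₀ (norm_nonneg _) (norm_nonneg _), WithLp.prod_norm_sq_eq_of_L2]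
    simp
  exact ⟨e.trans (Submodule.reflection (ℝ ∙ (e (WithLp.toLp 2 (‖u‖, (0 : F))) - u))ᗮ),
    Submodule.reflection_sub hn⟩

theorem sq_add_le_and_sq_sub_le_iff {t r b : ℝ} (hr : 0 ≤ r) :
    (t + r) ^ 2 ≤ b ∧ (t - r) ^ 2 ≤ b ↔ (|t| + r) ^ 2 ≤ b := by
  rcases abs_cases t with ⟨h, h0⟩ | ⟨h, h0⟩ <;> rw [h]
  · exact ⟨And.left, fun h => ⟨h, by nlinarith⟩⟩
  · exact ⟨fun h => by linarith [h.2], fun h => ⟨by nlinarith, by linarith⟩⟩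

variable [MeasurableSpace F] [BorelSpace F]

theorem volume_setOf_sq_add_norm_sq_le_one {z : ℝ} (hz : 0 ≤ z) :
    volume {y : F | z ^ 2 + ‖y‖ ^ 2 ≤ 1} =
      (Set.Iic (1 : ℝ)).indicator (fun z => volume (Metric.ball (0 : F) 1) *
        ENNReal.ofReal ((1 - z ^ 2) ^ ((Module.finrank ℝ F : ℝ) / 2))) z := by
  by_cases h1 : z ≤ 1
  · have hz1 : 0 ≤ 1 - z ^ 2 := by nlinarith
    rw [Set.indicator_of_mem (Set.mem_Iic.2 h1), mul_comm, Real.rpow_div_two_eq_sqrt _ hz1,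
      Real.rpow_natCast, ← Measure.addHaar_closedBall _ (0 : F) (Real.sqrt_nonneg _)]
    congr 1 with y
    rw [Set.mem_ofPred_eq, mem_closedBall_zero_iff, Real.le_sqrt (norm_nonneg _) hz1,
      le_sub_iff_add_le']
  · rw [Set.indicator_of_notMem (by simpa using h1)]
    convert measure_empty (μ := (volume : Measure F))
    ext y
    simp only [Set.mem_ofPred_eq, Set.mem_empty_iff_false, iff_false, not_le]
    nlinarith [sq_nonneg ‖y‖]

theorem volume_setOf_abs_add_sq_add_norm_sq_le_one {r : ℝ} (hr : 0 ≤ r) :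
    volume {p : ℝ × F | (|p.1| + r) ^ 2 + ‖p.2‖ ^ 2 ≤ 1} =
      2 * volume (Metric.ball (0 : F) 1) * ∫⁻ t in Set.Ioc r 1,
        ENNReal.ofReal ((1 - t ^ 2) ^ ((Module.finrank ℝ F : ℝ) / 2)) := by
  have hmeas : MeasurableSet {p : ℝ × F | (|p.1| + r) ^ 2 + ‖p.2‖ ^ 2 ≤ 1} :=
    measurableSet_le (by fun_prop) (by fun_prop)
  set section_volume : ℝ → ENNReal := (Set.Iic (1 : ℝ)).indicator
    fun z => volume (Metric.ball (0 : F) 1) *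
      ENNReal.ofReal ((1 - z ^ 2) ^ ((Module.finrank ℝ F : ℝ) / 2))
  calc volume {p : ℝ × F | (|p.1| + r) ^ 2 + ‖p.2‖ ^ 2 ≤ 1}
    _ = ∫⁻ t : ℝ, section_volume (|t| + r) := by
        rw [Measure.volume_eq_prod, Measure.prod_apply hmeas]
        exact lintegral_congr fun t =>
          volume_setOf_sq_add_norm_sq_le_one (add_nonneg (abs_nonneg t) hr)
    _ = 2 * ∫⁻ t in Set.Ioi r, section_volume t := by
        rw [lintegral_comp_abs fun t => section_volume (t + r), setLIntegral_Ioi_comp_add_right]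
    _ = _ := by
        rw [setLIntegral_indicator measurableSet_Iic, Set.inter_comm, Set.Ioi_inter_Iic,
          lintegral_const_mul' _ _ measure_ball_lt_top.ne, mul_assoc]

variable [MeasurableSpace E] [BorelSpace E]

theorem volume_closedBall_inter_closedBall_neg
    (hdim : Module.finrank ℝ E = Module.finrank ℝ F + 1) (u : E) :
    volume (Metric.closedBall u 1 ∩ Metric.closedBall (-u) 1) =
      2 * volume (Metric.ball (0 : F) 1) * ∫⁻ t in Set.Ioc ‖u‖ 1,
        ENNReal.ofReal ((1 - t ^ 2) ^ ((Module.finrank ℝ F : ℝ) / 2)) := by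
  obtain ⟨φ, hφ⟩ := exists_linearIsometryEquiv_prod_apply_eq (F := F) hdim u
  have hpres : MeasurePreserving (fun p : ℝ × F => φ (WithLp.toLp 2 p)) volume volume :=
    φ.measurePreserving.comp (WithLp.volume_preserving_toLp ℝ F)
  have hmeas : MeasurableSet (Metric.closedBall u 1 ∩ Metric.closedBall (-u) 1) :=
    Metric.isClosed_closedBall.measurableSet.inter Metric.isClosed_closedBall.measurableSet
  have hnorm (p : ℝ × F) (s : ℝ) :
      ‖φ (WithLp.toLp 2 p) + s • u‖ ^ 2 = (p.1 + s * ‖u‖) ^ 2 + ‖p.2‖ ^ 2 := by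
    conv_lhs => rw [← hφ]
    rw [← map_smul, ← map_add, φ.norm_map, WithLp.prod_norm_sq_eq_of_L2]
    simp
  rw [← volume_setOf_abs_add_sq_add_norm_sq_le_one (norm_nonneg u),
    ← hpres.measure_preimage hmeas.nullMeasurableSet]
  congr 1 with p
  have hadd := hnorm p 1
  have hsub := hnorm p (-1)
  simp only [one_smul, one_mul, neg_smul, ← sub_eq_add_neg, neg_mul] at hadd hsub
  rw [Set.mem_preimage, Set.mem_inter_iff, mem_closedBall_iff_norm, mem_closedBall_iff_norm,
    sub_neg_eq_add, ← sq_le_one_iff₀ (norm_nonneg _), ← sq_le_one_iff₀ (norm_nonneg _), hadd, hsub,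
    ← le_sub_iff_add_le, ← le_sub_iff_add_le, and_comm,
    sq_add_le_and_sq_sub_le_iff (norm_nonneg u), Set.mem_ofPred_eq, le_sub_iff_add_le]

end Lens

section Distance

variable {E : Type*} [NormedAddCommGroup E] [InnerProductSpace ℝ E]

/-- The linear change of variables `(u, w) ↦ a (w + u, w - u)`, which writes a pair of points in
terms of its half difference `a u` and its midpoint `a w`. -/
noncomputable def pairOfHalfDiffMidpoint (E : Type*) [NormedAddCommGroup E]
    [InnerProductSpace ℝ E] {a : ℝ} (ha : a ≠ 0) : (E × E) ≃L[ℝ] E × E where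
  toFun p := (a • (p.2 + p.1), a • (p.2 - p.1))
  invFun p := ((2 * a)⁻¹ • (p.1 - p.2), (2 * a)⁻¹ • (p.1 + p.2))
  map_add' p q := by ext <;> simp only [Prod.fst_add, Prod.snd_add] <;> module
  map_smul' s p := by
    ext <;> simp only [Prod.smul_fst, Prod.smul_snd, RingHom.id_apply] <;> module
  left_inv p := by
    ext <;> simp only [← smul_sub, ← smul_add, smul_smul] <;> match_scalars <;> field_simp <;> ring
  right_inv p := by
    ext <;> simp only [← smul_sub, ← smul_add, smul_smul] <;> match_scalars <;> field_simp <;> ring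

variable [FiniteDimensional ℝ E] [MeasurableSpace E] [BorelSpace E]

theorem exists_map_norm_fst_restrict_lens_eq_smul_capMeasure {n : ℕ}
    (hE : Module.finrank ℝ E = n) (hn : 1 ≤ n) :
    ∃ k : ENNReal, ((volume : Measure (E × E)).restrict
      {p | p.2 ∈ Metric.closedBall p.1 1 ∩ Metric.closedBall (-p.1) 1}).map (fun p => ‖p.1‖) =
        k • capMeasure n ((n + 1) / 2) := by
  have : Nontrivial E := Module.nontrivial_of_finrank_pos (R := ℝ) (by lia)
  set F := EuclideanSpace ℝ (Fin (n - 1))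
  have hF : Module.finrank ℝ F = n - 1 := finrank_euclideanSpace_fin
  have hmeas : MeasurableSet
      {p : E × E | p.2 ∈ Metric.closedBall p.1 1 ∩ Metric.closedBall (-p.1) 1} :=
    (measurableSet_le (f := fun p : E × E => dist p.2 p.1) (by fun_prop) measurable_const).inter
      (measurableSet_le (f := fun p : E × E => dist p.2 (-p.1)) (by fun_prop) measurable_const)
  have hexp : ((n : ℝ) + 1) / 2 - 1 = (Module.finrank ℝ F : ℝ) / 2 := by
    rw [hF, Nat.cast_sub hn]; push_cast; ring
  set tail : ℝ → ENNReal := fun r =>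
    ∫⁻ t in Set.Ioc r 1, ENNReal.ofReal ((1 - t ^ 2) ^ (((n : ℝ) + 1) / 2 - 1))
  have htail_meas : Measurable tail := measurable_setLIntegral_Ioc _ 1
  set v : ENNReal := 2 * volume (Metric.ball (0 : F) 1)
  refine ⟨v * (volume : Measure E).toSphere Set.univ, ?_⟩
  calc _ = (((volume : Measure (E × E)).restrict {p | p.2 ∈ Metric.closedBall p.1 1 ∩
        Metric.closedBall (-p.1) 1}).map Prod.fst).map norm :=
        (Measure.map_map measurable_norm measurable_fst).symm
    _ = ((volume : Measure E).withDensity ((v • tail) ∘ norm)).map norm := by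
        rw [Measure.volume_eq_prod, map_fst_restrict_prod _ _ hmeas]
        congr 2 with u
        simp only [tail, hexp]
        exact volume_closedBall_inter_closedBall_neg (F := F)
          (by rw [hE, hF, Nat.sub_add_cancel hn]) u
    _ = _ := by
        rw [map_withDensity_comp _ measurable_norm (htail_meas.const_smul v), map_norm_addHaar,
          withDensity_smul _ htail_meas, withDensity_smul_measure, smul_smul,
          capMeasure_eq_withDensity_restrict_Ioi, ← withDensity_mul _ (by fun_prop) htail_meas]
        congr 2 with r
        simp only [Pi.mul_apply, hE, tail, ← Nat.cast_pred hn, Real.rpow_natCast]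

theorem exists_map_dist_div_restrict_prod_eq_smul_capMeasure {n : ℕ}
    (hE : Module.finrank ℝ E = n) (hn : 1 ≤ n) {a : ℝ} (ha : 0 < a) (c : E) :
    ∃ k : ENNReal, ((volume : Measure (E × E)).restrict
      (Metric.closedBall c a ×ˢ Metric.closedBall c a)).map (fun p => dist p.1 p.2 / (2 * a)) =
        k • capMeasure n ((n + 1) / 2) := by
  set A : E × E → E × E := fun p => (c, c) + pairOfHalfDiffMidpoint E ha.ne' p with hA
  have hA_apply (p : E × E) : A p = (c + a • (p.2 + p.1), c + a • (p.2 - p.1)) := rfl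
  have hA_meas : Measurable A := by fun_prop
  have hball (y : E) : c + a • y ∈ Metric.closedBall c a ↔ ‖y‖ ≤ 1 := by
    rw [Metric.mem_closedBall, dist_self_add_left, norm_smul, Real.norm_of_nonneg ha.le,
      mul_le_iff_le_one_right ha]
  have hpre : A ⁻¹' (Metric.closedBall c a ×ˢ Metric.closedBall c a) =
      {p | p.2 ∈ Metric.closedBall p.1 1 ∩ Metric.closedBall (-p.1) 1} := by
    ext p
    rw [Set.mem_preimage, hA_apply, Set.mem_prod, hball, hball, Set.mem_ofPred_eq,
      Set.mem_inter_iff, mem_closedBall_iff_norm, mem_closedBall_iff_norm, sub_neg_eq_add, and_comm]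
  have hdist (p : E × E) : dist (A p).1 (A p).2 / (2 * a) = ‖p.1‖ := by
    have : a • (p.2 + p.1) - a • (p.2 - p.1) = (2 * a) • p.1 := by module
    rw [hA_apply, dist_add_left, dist_eq_norm, this, norm_smul, Real.norm_of_nonneg (by positivity),
      mul_div_cancel_left₀ _ (by positivity)]
  have : (volume : Measure (E × E)).IsAddHaarMeasure :=
    inferInstanceAs ((volume : Measure E).prod volume).IsAddHaarMeasure
  obtain ⟨j, hj⟩ := exists_eq_smul_map_affine (volume : Measure (E × E))
    (pairOfHalfDiffMidpoint E ha.ne') (c, c)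
  obtain ⟨k, hk⟩ := exists_map_norm_fst_restrict_lens_eq_smul_capMeasure hE hn
  refine ⟨j * k, ?_⟩
  rw [hj, ← hA, Measure.restrict_smul, Measure.restrict_map hA_meas
    (Metric.isClosed_closedBall.measurableSet.prod Metric.isClosed_closedBall.measurableSet), hpre,
    Measure.map_smul, Measure.map_map (by fun_prop) hA_meas, ← smul_smul, ← hk]
  simp only [Function.comp_def, hdist]
  rfl

theorem exists_map_dist_div_eq_smul_capMeasure {Ω : Type*} [MeasurableSpace Ω] {P : Measure Ω}
    [IsFiniteMeasure P] {n : ℕ} (hE : Module.finrank ℝ E = n) (hn : 1 ≤ n) {a : ℝ} (ha : 0 < a)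
    {c : E} {X₁ X₂ : Ω → E} (hX₁ : HasLaw X₁ (cond volume (Metric.closedBall c a)) P)
    (hX₂ : HasLaw X₂ (cond volume (Metric.closedBall c a)) P) (hind : IndepFun X₁ X₂ P) :
    ∃ k : ENNReal, P.map (fun ω => dist (X₁ ω) (X₂ ω) / (2 * a)) =
      k • capMeasure n ((n + 1) / 2) := by
  obtain ⟨k, hk⟩ := exists_map_dist_div_restrict_prod_eq_smul_capMeasure hE hn ha c
  have hpair := (indepFun_iff_hasLaw_prodMk_prod hX₁ hX₂).1 hind
  have hdist : Measurable fun p : E × E => dist p.1 p.2 / (2 * a) := by fun_prop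
  refine ⟨(volume (Metric.closedBall c a))⁻¹ * (volume (Metric.closedBall c a))⁻¹ * k, ?_⟩
  rw [← smul_smul, ← hk, Measure.volume_eq_prod, ← Measure.prod_restrict, ← Measure.map_smul,
    ← smul_smul, ← Measure.prod_smul_left, ← Measure.prod_smul_right, ← ProbabilityTheory.cond,
    ← hpair.map_eq,
    AEMeasurable.map_map_of_aemeasurable hdist.aemeasurable hpair.aemeasurable]
  rfl

end Distance

section MultiplicativeConvolution

theorem lintegral_comp_mul_right {t : ℝ} (ht : t ≠ 0) {f : ℝ → ENNReal} (hf : Measurable f) :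
    ∫⁻ x, f (x * t) = ENNReal.ofReal |t⁻¹| * ∫⁻ r, f r := by
  rw [← lintegral_map hf (measurable_mul_const t), Real.map_volume_mul_right ht,
    lintegral_smul_measure, smul_eq_mul]

theorem withDensity_mconv_withDensity {f g : ℝ → ENNReal} (hf : Measurable f)
    (hg : Measurable g) :
    volume.withDensity f ∗ₘ volume.withDensity g =
      volume.withDensity fun r => ∫⁻ t, ENNReal.ofReal |t⁻¹| * f (r / t) * g t := by
  refine Measure.ext_of_lintegral _ fun φ hφ => ?_
  have hscale {t : ℝ} (ht : t ≠ 0) : ∫⁻ x, f x * (g t * φ (x * t)) =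
      ∫⁻ r, ENNReal.ofReal |t⁻¹| * f (r / t) * g t * φ r := by
    have hF : Measurable fun r => f (r / t) * (g t * φ r) := by fun_prop
    calc ∫⁻ x, f x * (g t * φ (x * t))
      _ = ∫⁻ x, f (x * t / t) * (g t * φ (x * t)) := by simp only [mul_div_cancel_right₀ _ ht]
      _ = _ := by
        rw [lintegral_comp_mul_right ht hF, ← lintegral_const_mul _ hF]
        simp only [mul_assoc]
  calc ∫⁻ x, φ x ∂(volume.withDensity f ∗ₘ volume.withDensity g)
    _ = ∫⁻ x, ∫⁻ t, f x * (g t * φ (x * t)) := by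
      rw [Measure.lintegral_mconv hφ, lintegral_withDensity_eq_lintegral_mul _ hf
        (Measurable.lintegral_prod_right' (f := fun p : ℝ × ℝ => φ (p.1 * p.2)) (by fun_prop))]
      refine lintegral_congr fun x => ?_
      rw [Pi.mul_apply, lintegral_withDensity_eq_lintegral_mul _ hg (by fun_prop),
        ← lintegral_const_mul _ (by fun_prop)]
      rfl
    _ = ∫⁻ t, ∫⁻ r, ENNReal.ofReal |t⁻¹| * f (r / t) * g t * φ r := by
      rw [lintegral_lintegral_swap (by fun_prop)]
      refine lintegral_congr_ae ?_
      filter_upwards [Measure.ae_ne volume 0] with t ht using hscale ht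
    _ = ∫⁻ r, (∫⁻ t, ENNReal.ofReal |t⁻¹| * f (r / t) * g t) * φ r := by
      rw [lintegral_lintegral_swap (by fun_prop)]
      exact lintegral_congr fun r => lintegral_mul_const _ (by fun_prop)
    _ = _ := by
      rw [lintegral_withDensity_eq_lintegral_mul _ (Measurable.lintegral_prod_right'
        (f := fun p : ℝ × ℝ => ENNReal.ofReal |p.2⁻¹| * f (p.1 / p.2) * g p.2) (by fun_prop)) hφ]
      rfl

theorem withDensity_restrict_Ioo_mconv {f g : ℝ → ENNReal} (hf : Measurable f)
    (hg : Measurable g) :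
    (volume.restrict (Set.Ioo 0 1)).withDensity f ∗ₘ
        (volume.restrict (Set.Ioo 0 1)).withDensity g =
      (volume.restrict (Set.Ioo 0 1)).withDensity fun r =>
        ∫⁻ t in Set.Ioc r 1, ENNReal.ofReal t⁻¹ * f (r / t) * g t := by
  rw [← withDensity_indicator measurableSet_Ioo, ← withDensity_indicator measurableSet_Ioo,
    ← withDensity_indicator measurableSet_Ioo,
    withDensity_mconv_withDensity (hf.indicator measurableSet_Ioo) (hg.indicator measurableSet_Ioo)]
  congr 1 with r
  by_cases hr : r ∈ Set.Ioo (0 : ℝ) 1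
  · rw [Set.indicator_of_mem hr, setLIntegral_congr Ioo_ae_eq_Ioc.symm,
      ← lintegral_indicator measurableSet_Ioo]
    refine lintegral_congr fun t => ?_
    by_cases ht : t ∈ Set.Ioo r 1
    · have ht0 : 0 < t := hr.1.trans ht.1
      have hrt : r / t ∈ Set.Ioo (0 : ℝ) 1 := ⟨div_pos hr.1 ht0, (div_lt_one ht0).2 ht.1⟩
      simp [Set.indicator_of_mem, ht, hrt, show t ∈ Set.Ioo (0 : ℝ) 1 from ⟨ht0, ht.2⟩,
        abs_of_pos ht0]
    · rw [Set.indicator_of_notMem ht]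
      by_cases ht01 : t ∈ Set.Ioo (0 : ℝ) 1
      · rw [Set.indicator_of_notMem (a := r / t), mul_zero, zero_mul]
        exact fun h => ht ⟨(div_lt_one ht01.1).1 h.2, ht01.2⟩
      · rw [Set.indicator_of_notMem ht01, mul_zero]
  · rw [Set.indicator_of_notMem hr]
    refine (lintegral_congr fun t => ?_).trans lintegral_zero
    by_cases ht : t ∈ Set.Ioo (0 : ℝ) 1
    · rw [Set.indicator_of_notMem (a := r / t), mul_zero, zero_mul]
      refine fun h => hr ⟨?_, ((div_lt_one ht.1).1 h.2).trans ht.2⟩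
      exact (div_pos_iff_of_pos_right ht.1).1 h.1
    · rw [Set.indicator_of_notMem ht, mul_zero]

end MultiplicativeConvolution

section Beta

theorem betaMeasure_eq_withDensity_restrict (α β : ℝ) :
    betaMeasure α β = (volume.restrict (Set.Ioo 0 1)).withDensity fun x =>
      ENNReal.ofReal (1 / beta α β * x ^ (α - 1) * (1 - x) ^ (β - 1)) := by
  rw [betaMeasure, ← withDensity_indicator measurableSet_Ioo]
  congr 1 with x
  by_cases hx : x ∈ Set.Ioo (0 : ℝ) 1
  · rw [Set.indicator_of_mem hx, betaPDF_of_pos_lt_one hx.1 hx.2]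
  · rw [Set.indicator_of_notMem hx, betaPDF_eq, if_neg (Set.mem_Ioo.not.1 hx), ENNReal.ofReal_zero]

theorem ae_mem_Ioo_betaMeasure (α β : ℝ) : ∀ᵐ x ∂(betaMeasure α β), x ∈ Set.Ioo (0 : ℝ) 1 := by
  rw [betaMeasure_eq_withDensity_restrict]
  exact (withDensity_absolutelyContinuous _ _).ae_le (ae_restrict_mem measurableSet_Ioo)

theorem beta_one_right {α : ℝ} (hα : 0 < α) : beta α 1 = 1 / α := by
  rw [beta, Real.Gamma_add_one hα.ne', Real.Gamma_one]
  field_simp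

theorem betaMeasure_one_right {α : ℝ} (hα : 0 < α) :
    betaMeasure α 1 = (volume.restrict (Set.Ioo 0 1)).withDensity fun x =>
      ENNReal.ofReal (α * x ^ (α - 1)) := by
  rw [betaMeasure_eq_withDensity_restrict, beta_one_right hα]
  simp only [one_div_one_div, sub_self, Real.rpow_zero, mul_one]

theorem betaMeasure_one_one : betaMeasure 1 1 = volume.restrict (Set.Ioo 0 1) := by
  rw [betaMeasure_one_right one_pos]
  simp only [sub_self, Real.rpow_zero, mul_one, ENNReal.ofReal_one]
  exact withDensity_one

theorem setLIntegral_Ioo_comp_rpow {p : ℝ} (hp : 0 < p) (f : ℝ → ENNReal) :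
    ∫⁻ x in Set.Ioo (0 : ℝ) 1, f x =
      ∫⁻ t in Set.Ioo (0 : ℝ) 1, ENNReal.ofReal (p * t ^ (p - 1)) * f (t ^ p) := by
  have himage : (fun t : ℝ => t ^ p) '' Set.Ioo 0 1 = Set.Ioo 0 1 := by
    ext x
    constructor
    · rintro ⟨t, ht, rfl⟩
      exact ⟨Real.rpow_pos_of_pos ht.1 p, Real.rpow_lt_one ht.1.le ht.2 hp⟩
    · exact fun hx => ⟨x ^ p⁻¹, ⟨Real.rpow_pos_of_pos hx.1 _,
        Real.rpow_lt_one hx.1.le hx.2 (inv_pos.2 hp)⟩, Real.rpow_inv_rpow hx.1.le hp.ne'⟩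
  have hsubst := lintegral_image_eq_lintegral_abs_deriv_mul measurableSet_Ioo
    (fun t (ht : t ∈ Set.Ioo (0 : ℝ) 1) =>
      (Real.hasDerivAt_rpow_const (p := p) (Or.inl ht.1.ne')).hasDerivWithinAt)
    (fun x hx y hy hxy => (Real.rpow_left_inj hx.1.le hy.1.le hp.ne').1 hxy) f
  rw [himage] at hsubst
  rw [hsubst]
  refine setLIntegral_congr_fun measurableSet_Ioo fun t ht => ?_
  rw [abs_of_pos (mul_pos hp (Real.rpow_pos_of_pos ht.1 _))]

theorem map_rpow_one_div_betaMeasure {p : ℝ} (hp : 0 < p) (γ δ : ℝ) :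
    (betaMeasure γ δ).map (fun x => x ^ (1 / p)) =
      (volume.restrict (Set.Ioo 0 1)).withDensity fun t =>
        ENNReal.ofReal (p / beta γ δ * t ^ (p * γ - 1) * (1 - t ^ p) ^ (δ - 1)) := by
  refine Measure.ext_of_lintegral _ fun φ hφ => ?_
  rw [lintegral_map hφ (by fun_prop), betaMeasure_eq_withDensity_restrict,
    lintegral_withDensity_eq_lintegral_mul _ (by fun_prop) (by fun_prop),
    lintegral_withDensity_eq_lintegral_mul _ (by fun_prop) hφ, setLIntegral_Ioo_comp_rpow hp]
  refine setLIntegral_congr_fun measurableSet_Ioo fun t ht => ?_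
  have hexp : t ^ (p * γ - 1) = t ^ (p - 1) * (t ^ p) ^ (γ - 1) := by
    rw [← Real.rpow_mul ht.1.le, ← Real.rpow_add ht.1]
    ring_nf
  have hroot : (t ^ p) ^ (1 / p) = t := by rw [one_div, Real.rpow_rpow_inv ht.1.le hp.ne']
  simp only [Pi.mul_apply]
  rw [hroot, ← mul_assoc, ← ENNReal.ofReal_mul
    (mul_nonneg hp.le (Real.rpow_nonneg ht.1.le _)), hexp]
  ring_nf

theorem isProbabilityMeasure_map_rpow_betaMeasure {α β : ℝ} (hα : 0 < α) (hβ : 0 < β) (p : ℝ) :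
    IsProbabilityMeasure ((betaMeasure α β).map fun x => x ^ p) :=
  have := isProbabilityMeasureBeta hα hβ
  Measure.isProbabilityMeasure_map (by fun_prop)

theorem map_rpow_one_div_uniform {α : ℝ} (hα : 0 < α) :
    (volume.restrict (Set.Ioo (0 : ℝ) 1)).map (fun x => x ^ (1 / α)) = betaMeasure α 1 := by
  rw [← betaMeasure_one_one, map_rpow_one_div_betaMeasure hα, betaMeasure_one_right hα,
    beta_one_right one_pos]
  simp only [div_one, mul_one, sub_self, Real.rpow_zero]

theorem betaMeasure_mconv_map_sqrt_eq_smul_capMeasure {α δ : ℝ} (hα : 0 < α) (hδ : 0 < δ) :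
    betaMeasure α 1 ∗ₘ (betaMeasure ((α + 1) / 2) δ).map (fun x => x ^ (1 / 2 : ℝ)) =
      ENNReal.ofReal (2 * α / beta ((α + 1) / 2) δ) • capMeasure α δ := by
  have hbeta : 0 < beta ((α + 1) / 2) δ := beta_pos (by positivity) hδ
  have htail := measurable_setLIntegral_Ioc
    (fun t : ℝ => ENNReal.ofReal ((1 - t ^ 2) ^ (δ - 1))) 1
  rw [betaMeasure_one_right hα, map_rpow_one_div_betaMeasure two_pos, capMeasure,
    withDensity_restrict_Ioo_mconv (by fun_prop) (by fun_prop), ← withDensity_smul _ (by fun_prop)]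
  refine withDensity_congr_ae ?_
  filter_upwards [ae_restrict_mem measurableSet_Ioo] with r hr
  rw [Pi.smul_apply, smul_eq_mul, ← mul_assoc, ← lintegral_const_mul _ (by fun_prop)]
  refine setLIntegral_congr_fun measurableSet_Ioc fun t ht => ?_
  have ht0 : 0 < t := hr.1.trans ht.1
  have hr0 := hr.1
  have hexp : t ^ (2 * ((α + 1) / 2) - 1) = t * t ^ (α - 1) := by
    rw [← Real.rpow_one_add' ht0.le (by linarith)]
    ring_nf
  simp only [Real.rpow_two, hexp, Real.div_rpow hr.1.le ht0.le]
  rw [← ENNReal.ofReal_mul (by positivity), ← ENNReal.ofReal_mul (by positivity),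
    ← ENNReal.ofReal_mul (by positivity), ← ENNReal.ofReal_mul (by positivity)]
  congr 1
  field_simp

end Beta

section BallDistLaw

/-- The law of `B₁ * √B₂` for independent `B₁` and `B₂` with Beta distributions of parameters
`(n, 1)` and `((n + 1) / 2, (n + 1) / 2)`: the law of the distance of two independent uniform points
of an `n`-dimensional ball, normalised by the diameter. -/
noncomputable def ballDistLaw (n : ℕ) : Measure ℝ :=
  betaMeasure n 1 ∗ₘ
    (betaMeasure (((n : ℝ) + 1) / 2) (((n : ℝ) + 1) / 2)).map fun x => x ^ (1 / 2 : ℝ)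

variable {n : ℕ}

theorem isProbabilityMeasure_ballDistLaw (hn : 1 ≤ n) : IsProbabilityMeasure (ballDistLaw n) := by
  have := isProbabilityMeasureBeta (α := (n : ℝ)) (by positivity) one_pos
  have hγ : 0 < ((n : ℝ) + 1) / 2 := by positivity
  have := isProbabilityMeasure_map_rpow_betaMeasure hγ hγ (1 / 2)
  exact Measure.probabilitymeasure_of_probabilitymeasures_mconv _ _

theorem ballDistLaw_eq_smul_capMeasure (hn : 1 ≤ n) :
    ballDistLaw n = ENNReal.ofReal (2 * n / beta (((n : ℝ) + 1) / 2) (((n : ℝ) + 1) / 2)) •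
      capMeasure n ((n + 1) / 2) :=
  betaMeasure_mconv_map_sqrt_eq_smul_capMeasure (by positivity) (by positivity)

theorem setLIntegral_Ioc_ofReal_one_sub_sq_rpow {r p : ℝ} (hr0 : 0 ≤ r) (hr1 : r ≤ 1)
    (hp : 0 ≤ p) : ∫⁻ t in Set.Ioc r 1, ENNReal.ofReal ((1 - t ^ 2) ^ p) =
      ENNReal.ofReal (∫ t in r..1, (1 - t ^ 2) ^ p) := by
  have hcont : Continuous fun t : ℝ => (1 - t ^ 2) ^ p :=
    Continuous.rpow_const (by fun_prop) fun _ => Or.inr hp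
  rw [intervalIntegral.integral_of_le hr1,
    ofReal_integral_eq_lintegral_ofReal hcont.integrableOn_Ioc]
  filter_upwards [ae_restrict_mem measurableSet_Ioc] with t ht
  exact Real.rpow_nonneg (by nlinarith [ht.1, ht.2]) p

theorem ballDistLaw_eq_withDensity (hn : 1 ≤ n) :
    ballDistLaw n = (volume.restrict (Set.Ioo 0 1)).withDensity
      fun l => ENNReal.ofReal (ballDistDensity n l) := by
  have hn1 : (1 : ℝ) ≤ n := by exact_mod_cast hn
  have hconst : 2 * n / beta (((n : ℝ) + 1) / 2) (((n : ℝ) + 1) / 2) =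
      2 * n * Real.Gamma (n + 1) / Real.Gamma ((n : ℝ) / 2 + 1 / 2) ^ 2 := by
    rw [beta, add_halves, ← add_div, div_div_eq_mul_div, pow_two]
  have htail := measurable_setLIntegral_Ioc
    (fun t : ℝ => ENNReal.ofReal ((1 - t ^ 2) ^ (((n : ℝ) + 1) / 2 - 1))) 1
  rw [ballDistLaw_eq_smul_capMeasure hn, capMeasure, ← withDensity_smul _ (by fun_prop), hconst]
  refine withDensity_congr_ae ?_
  filter_upwards [ae_restrict_mem measurableSet_Ioo] with l hl
  have hl0 : 0 ≤ l := hl.1.le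
  rw [Pi.smul_apply, smul_eq_mul,
    setLIntegral_Ioc_ofReal_one_sub_sq_rpow hl0 hl.2.le (by linarith),
    ← ENNReal.ofReal_mul (by positivity), ← ENNReal.ofReal_mul (by positivity), ballDistDensity,
    show ((n : ℝ) + 1) / 2 - 1 = (n - 1) / 2 by ring]
  ring_nf

variable {E : Type*} [NormedAddCommGroup E] [InnerProductSpace ℝ E] [FiniteDimensional ℝ E]
  [MeasurableSpace E] [BorelSpace E] {Ω : Type*} [MeasurableSpace Ω] {P : Measure Ω}

theorem hasLaw_dist_div_ballDistLaw [IsProbabilityMeasure P] (hE : Module.finrank ℝ E = n)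
    (hn : 1 ≤ n) {a : ℝ} (ha : 0 < a) {c : E} {X₁ X₂ : Ω → E}
    (hX₁ : pdf.IsUniform X₁ (Metric.closedBall c a) P volume)
    (hX₂ : pdf.IsUniform X₂ (Metric.closedBall c a) P volume) (hind : IndepFun X₁ X₂ P) :
    HasLaw (fun ω => dist (X₁ ω) (X₂ ω) / (2 * a)) (ballDistLaw n) P := by
  have hpos : volume (Metric.closedBall c a) ≠ 0 := (Metric.measure_closedBall_pos _ _ ha).ne'
  have hfin : volume (Metric.closedBall c a) ≠ ⊤ := measure_closedBall_lt_top.ne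
  have hX₁m := hX₁.aemeasurable hpos hfin
  have hX₂m := hX₂.aemeasurable hpos hfin
  have hm : AEMeasurable (fun ω => dist (X₁ ω) (X₂ ω) / (2 * a)) P := by fun_prop
  have := isProbabilityMeasure_ballDistLaw hn
  have := Measure.isProbabilityMeasure_map hm
  obtain ⟨k, hk⟩ :=
    exists_map_dist_div_eq_smul_capMeasure hE hn ha ⟨hX₁m, hX₁⟩ ⟨hX₂m, hX₂⟩ hind
  exact ⟨hm, eq_of_eq_smul_measure hk (ballDistLaw_eq_smul_capMeasure hn)⟩

end BallDistLaw

section Moments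

theorem ofReal_rpow_cpow {x : ℝ} (hx : 0 < x) (p : ℝ) (s : ℂ) :
    ((x ^ p : ℝ) : ℂ) ^ s = (x : ℂ) ^ (p * s) := by
  rw [Complex.cpow_def_of_ne_zero (Complex.ofReal_ne_zero.2 (Real.rpow_pos_of_pos hx p).ne'),
    Complex.cpow_def_of_ne_zero (Complex.ofReal_ne_zero.2 hx.ne'),
    ← Complex.ofReal_log (Real.rpow_nonneg hx.le p), ← Complex.ofReal_log hx.le, Real.log_rpow hx]
  push_cast
  ring_nf

section Mconv

variable {μ ν : Measure ℝ}

theorem ae_prod_cpow_mul_eq (hμ : ∀ᵐ x ∂μ, 0 ≤ x) (hν : ∀ᵐ y ∂ν, 0 ≤ y) (s : ℂ) :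
    (fun p : ℝ × ℝ => ((p.1 * p.2 : ℝ) : ℂ) ^ s) =ᵐ[μ.prod ν]
      fun p => (p.1 : ℂ) ^ s * (p.2 : ℂ) ^ s := by
  filter_upwards [Measure.quasiMeasurePreserving_fst.ae hμ,
    Measure.quasiMeasurePreserving_snd.ae hν] with p h1 h2
  rw [Complex.ofReal_mul, Complex.mul_cpow_ofReal_nonneg h1 h2]

theorem integral_cpow_mconv [SFinite μ] [SFinite ν] (hμ : ∀ᵐ x ∂μ, 0 ≤ x)
    (hν : ∀ᵐ y ∂ν, 0 ≤ y) (s : ℂ) :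
    ∫ z : ℝ, (z : ℂ) ^ s ∂(μ ∗ₘ ν) = (∫ x : ℝ, (x : ℂ) ^ s ∂μ) * ∫ y : ℝ, (y : ℂ) ^ s ∂ν := by
  have hcpow : Measurable fun z : ℝ => (z : ℂ) ^ s := by fun_prop
  rw [Measure.mconv, integral_map (by fun_prop) hcpow.aestronglyMeasurable,
    integral_congr_ae (ae_prod_cpow_mul_eq hμ hν s)]
  exact integral_prod_mul (fun x : ℝ => (x : ℂ) ^ s) fun y : ℝ => (y : ℂ) ^ s

theorem integrable_cpow_mconv_iff_prod (hμ : ∀ᵐ x ∂μ, 0 ≤ x)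
    (hν : ∀ᵐ y ∂ν, 0 ≤ y) (s : ℂ) :
    Integrable (fun z : ℝ => (z : ℂ) ^ s) (μ ∗ₘ ν) ↔
      Integrable (fun p : ℝ × ℝ => (p.1 : ℂ) ^ s * (p.2 : ℂ) ^ s) (μ.prod ν) := by
  have hcpow : Measurable fun z : ℝ => (z : ℂ) ^ s := by fun_prop
  rw [Measure.mconv, integrable_map_measure hcpow.aestronglyMeasurable (by fun_prop),
    Function.comp_def, integrable_congr (ae_prod_cpow_mul_eq hμ hν s)]

theorem integrable_cpow_of_mconv [SFinite μ] [SFinite ν] [NeZero ν] (hμ : ∀ᵐ x ∂μ, 0 ≤ x)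
    (hν : ∀ᵐ y ∂ν, 0 < y) {s : ℂ} (h : Integrable (fun z : ℝ => (z : ℂ) ^ s) (μ ∗ₘ ν)) :
    Integrable (fun x : ℝ => (x : ℂ) ^ s) μ := by
  rw [integrable_cpow_mconv_iff_prod hμ (hν.mono fun _ => le_of_lt)] at h
  obtain ⟨y, hy, hy0⟩ := (h.prod_left_ae.and hν).exists
  have hunit : IsUnit ((y : ℂ) ^ s) :=
    (Complex.cpow_ne_zero_iff.2 (Or.inl (Complex.ofReal_ne_zero.2 hy0.ne'))).isUnit
  exact (integrable_mul_const_iff hunit _).1 hy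

end Mconv

section Beta

variable {α β : ℝ} {s : ℂ}

theorem toReal_beta_density_smul_cpow (hα : 0 < α) (hβ : 0 < β) (s : ℂ) {x : ℝ}
    (hx : x ∈ Set.Ioo (0 : ℝ) 1) :
    (ENNReal.ofReal (1 / beta α β * x ^ (α - 1) * (1 - x) ^ (β - 1))).toReal • (x : ℂ) ^ s =
      ((1 / beta α β : ℝ) : ℂ) * ((x : ℂ) ^ ((α : ℂ) + s - 1) * (1 - (x : ℂ)) ^ ((β : ℂ) - 1)) := by
  have hx0 : 0 < x := hx.1
  have h1x : 0 < 1 - x := sub_pos.2 hx.2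
  have hbeta : 0 < beta α β := beta_pos hα hβ
  have hexp : (α : ℂ) + s - 1 = ((α - 1 : ℝ) : ℂ) + s := by push_cast; ring
  rw [ENNReal.toReal_ofReal (by positivity), Complex.real_smul, Complex.ofReal_mul,
    Complex.ofReal_mul, Complex.ofReal_cpow hx0.le, Complex.ofReal_cpow h1x.le, hexp,
    Complex.cpow_add _ _ (Complex.ofReal_ne_zero.2 hx0.ne')]
  push_cast
  ring

theorem integrable_cpow_betaMeasure_iff_integrableOn (hα : 0 < α) (hβ : 0 < β) :
    Integrable (fun x : ℝ => (x : ℂ) ^ s) (betaMeasure α β) ↔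
      IntegrableOn (fun x : ℝ => (x : ℂ) ^ ((α : ℂ) + s - 1) * (1 - (x : ℂ)) ^ ((β : ℂ) - 1))
        (Set.Ioo 0 1) := by
  have hbeta : beta α β ≠ 0 := (beta_pos hα hβ).ne'
  rw [betaMeasure_eq_withDensity_restrict, integrable_withDensity_iff_integrable_smul'
    (by fun_prop) (.of_forall fun _ => ENNReal.ofReal_lt_top), ← IntegrableOn,
    integrableOn_congr_fun (fun x hx => toReal_beta_density_smul_cpow hα hβ s hx) measurableSet_Ioo]
  exact integrable_const_mul_iff (by simp [hbeta]) _

theorem integrable_cpow_betaMeasure_iff (hα : 0 < α) (hβ : 0 < β) :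
    Integrable (fun x : ℝ => (x : ℂ) ^ s) (betaMeasure α β) ↔ -α < s.re := by
  rw [integrable_cpow_betaMeasure_iff_integrableOn hα hβ]
  constructor
  -- away from `1` the factor `(1 - x) ^ (β - 1)` can be divided out, leaving a power of `x`
  · intro h
    have hcont : ContinuousOn (fun x : ℝ => (1 - (x : ℂ)) ^ (1 - (β : ℂ))) (Set.Icc 0 (1 / 2)) := by
      refine ContinuousOn.cpow_const (by fun_prop) fun x hx => Or.inl ?_
      simp only [Complex.sub_re, Complex.one_re, Complex.ofReal_re]
      linarith [hx.2]
    have hhalf :=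
      (h.mono_set (Set.Ioo_subset_Ioo_right one_half_lt_one.le)).mul_continuousOn_of_subset hcont
        measurableSet_Ioo isCompact_Icc Set.Ioo_subset_Icc_self
    have hcancel : Set.EqOn (fun x : ℝ => (x : ℂ) ^ ((α : ℂ) + s - 1) *
        (1 - (x : ℂ)) ^ ((β : ℂ) - 1) * (1 - (x : ℂ)) ^ (1 - (β : ℂ)))
        (fun x : ℝ => (x : ℂ) ^ ((α : ℂ) + s - 1)) (Set.Ioo 0 (1 / 2)) := fun x hx => by
      have h1x : (1 - (x : ℂ)) ≠ 0 := by
        rw [← Complex.ofReal_one, ← Complex.ofReal_sub]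
        exact Complex.ofReal_ne_zero.2 (by linarith [hx.2])
      simp only [mul_assoc, ← Complex.cpow_add _ _ h1x, sub_add_sub_cancel, sub_self,
        Complex.cpow_zero, mul_one]
    have := (intervalIntegral.integrableOn_Ioo_cpow_iff one_half_pos).1
      ((integrableOn_congr_fun hcancel measurableSet_Ioo).1 hhalf)
    simp only [Complex.sub_re, Complex.add_re, Complex.ofReal_re, Complex.one_re] at this
    linarith
  · intro h
    rw [← intervalIntegrable_iff_integrableOn_Ioo_of_le zero_le_one]
    exact Complex.betaIntegral_convergent (by simp; linarith) (by simpa using hβ)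

theorem integral_cpow_betaMeasure (hα : 0 < α) (hβ : 0 < β) (hs : -α < s.re) :
    ∫ x : ℝ, (x : ℂ) ^ s ∂(betaMeasure α β) =
      Complex.Gamma (α + s) * Complex.Gamma (α + β) /
        (Complex.Gamma α * Complex.Gamma (α + s + β)) := by
  have hαs : 0 < ((α : ℂ) + s).re := by simp; linarith
  have hβ' : 0 < (β : ℂ).re := by simpa
  have hβ0 : Complex.Gamma β ≠ 0 := Complex.Gamma_ne_zero_of_re_pos hβ'
  rw [betaMeasure_eq_withDensity_restrict, integral_withDensity_eq_integral_toReal_smul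
    (by fun_prop) (.of_forall fun _ => ENNReal.ofReal_lt_top),
    setIntegral_congr_fun measurableSet_Ioo fun x hx => toReal_beta_density_smul_cpow hα hβ s hx,
    integral_const_mul, ← integral_Ioc_eq_integral_Ioo,
    ← intervalIntegral.integral_of_le zero_le_one, ← Complex.betaIntegral,
    Complex.betaIntegral_eq_Gamma_mul_div _ _ hαs hβ', beta]
  push_cast [← Complex.Gamma_ofReal]
  field_simp

theorem integral_cpow_betaMeasure_one_right (hα : 0 < α) (hs : -α < s.re) :
    ∫ x : ℝ, (x : ℂ) ^ s ∂(betaMeasure α 1) = α / (α + s) := by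
  have hαs : 0 < ((α : ℂ) + s).re := by simp; linarith
  have hαs0 : (α : ℂ) + s ≠ 0 := fun h => by simp [h] at hαs
  have hα0 : (α : ℂ) ≠ 0 := Complex.ofReal_ne_zero.2 hα.ne'
  have hΓ : Complex.Gamma α ≠ 0 := Complex.Gamma_ne_zero_of_re_pos (by simpa)
  have hΓs : Complex.Gamma (α + s) ≠ 0 := Complex.Gamma_ne_zero_of_re_pos hαs
  rw [integral_cpow_betaMeasure hα one_pos hs, Complex.ofReal_one, Complex.Gamma_add_one _ hα0,
    Complex.Gamma_add_one _ hαs0]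
  field_simp

theorem ae_rpow_cpow_betaMeasure (α β p : ℝ) (s : ℂ) :
    (fun x : ℝ => ((x ^ p : ℝ) : ℂ) ^ s) =ᵐ[betaMeasure α β] fun x => (x : ℂ) ^ (p * s) :=
  (ae_mem_Ioo_betaMeasure α β).mono fun _ hx => ofReal_rpow_cpow hx.1 p s

theorem integrable_cpow_map_rpow_betaMeasure_iff (hα : 0 < α) (hβ : 0 < β) (p : ℝ) :
    Integrable (fun x : ℝ => (x : ℂ) ^ s) ((betaMeasure α β).map fun x => x ^ p) ↔
      -α < p * s.re := by
  have hcpow : Measurable fun z : ℝ => (z : ℂ) ^ s := by fun_prop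
  rw [integrable_map_measure hcpow.aestronglyMeasurable (by fun_prop), Function.comp_def,
    integrable_congr (ae_rpow_cpow_betaMeasure α β p s), integrable_cpow_betaMeasure_iff hα hβ,
    Complex.re_ofReal_mul]

theorem integral_cpow_map_rpow_betaMeasure (α β p : ℝ) (s : ℂ) :
    ∫ x : ℝ, (x : ℂ) ^ s ∂((betaMeasure α β).map fun x => x ^ p) =
      ∫ x : ℝ, (x : ℂ) ^ (p * s) ∂(betaMeasure α β) := by
  have hcpow : Measurable fun z : ℝ => (z : ℂ) ^ s := by fun_prop
  rw [integral_map (by fun_prop) hcpow.aestronglyMeasurable,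
    integral_congr_ae (ae_rpow_cpow_betaMeasure α β p s)]

theorem ae_pos_betaMeasure (α β : ℝ) : ∀ᵐ x ∂(betaMeasure α β), 0 < x :=
  (ae_mem_Ioo_betaMeasure α β).mono fun _ hx => hx.1

theorem ae_pos_map_rpow_betaMeasure (α β p : ℝ) :
    ∀ᵐ x ∂((betaMeasure α β).map fun x => x ^ p), 0 < x :=
  (ae_map_iff (by fun_prop) measurableSet_Ioi).2
    ((ae_pos_betaMeasure α β).mono fun _ hx => Real.rpow_pos_of_pos hx p)

end Beta

variable {n : ℕ} {s : ℂ}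

theorem integrable_cpow_ballDistLaw_iff (hn : 1 ≤ n) :
    Integrable (fun x : ℝ => (x : ℂ) ^ s) (ballDistLaw n) ↔ -(n : ℝ) < s.re := by
  have hn0 : (0 : ℝ) < n := by exact_mod_cast hn
  have hγ : 0 < ((n : ℝ) + 1) / 2 := by positivity
  have := isProbabilityMeasureBeta hn0 one_pos
  have := isProbabilityMeasure_map_rpow_betaMeasure hγ hγ (1 / 2)
  have hB₁ := (ae_pos_betaMeasure n 1).mono fun _ => le_of_lt
  have hB₂ := ae_pos_map_rpow_betaMeasure (((n : ℝ) + 1) / 2) (((n : ℝ) + 1) / 2) (1 / 2)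
  rw [ballDistLaw]
  refine ⟨fun h => (integrable_cpow_betaMeasure_iff hn0 one_pos).1
    (integrable_cpow_of_mconv hB₁ hB₂ h), fun hs => ?_⟩
  rw [integrable_cpow_mconv_iff_prod hB₁ (hB₂.mono fun _ => le_of_lt)]
  exact ((integrable_cpow_betaMeasure_iff hn0 one_pos).2 hs).mul_prod
    ((integrable_cpow_map_rpow_betaMeasure_iff hγ hγ _).2 (by linarith))

theorem integral_cpow_ballDistLaw (hn : 1 ≤ n) (hs : -(n : ℝ) < s.re) :
    ∫ x : ℝ, (x : ℂ) ^ s ∂(ballDistLaw n) =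
      (ballDistConst n : ℂ) * Complex.Gamma ((n : ℂ) / 2 + s / 2 + 1 / 2) /
        (((n : ℂ) + s) * Complex.Gamma ((n : ℂ) + s / 2 + 1)) := by
  have hn0 : (0 : ℝ) < n := by exact_mod_cast hn
  have hγ : 0 < ((n : ℝ) + 1) / 2 := by positivity
  have := isProbabilityMeasureBeta hn0 one_pos
  have := isProbabilityMeasureBeta hγ hγ
  have hs' : -(((n : ℝ) + 1) / 2) < (((1 / 2 : ℝ) : ℂ) * s).re := by
    rw [Complex.re_ofReal_mul]; linarith
  rw [ballDistLaw, integral_cpow_mconv ((ae_pos_betaMeasure _ _).mono fun _ => le_of_lt)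
    ((ae_pos_map_rpow_betaMeasure _ _ _).mono fun _ => le_of_lt),
    integral_cpow_betaMeasure_one_right hn0 hs, integral_cpow_map_rpow_betaMeasure,
    integral_cpow_betaMeasure hγ hγ hs', ballDistConst]
  push_cast [← Complex.Gamma_ofReal]
  rw [show ((n : ℂ) + 1) / 2 + 1 / 2 * s = n / 2 + s / 2 + 1 / 2 by ring,
    show (n : ℂ) / 2 + s / 2 + 1 / 2 + (n + 1) / 2 = n + s / 2 + 1 by ring, add_halves,
    show ((n : ℂ) + 1) / 2 = n / 2 + 1 / 2 by ring]
  simp only [div_eq_mul_inv, mul_inv]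
  ring

end Moments

section GammaForms

variable {n : ℕ} {s : ℂ}

theorem integral_cpow_ballDistLaw_eq_Gamma_mul_Gamma_div (hn : 1 ≤ n) (hs : -(n : ℝ) < s.re) :
    ∫ x : ℝ, (x : ℂ) ^ s ∂(ballDistLaw n) = (ballDistConst n : ℂ) *
      (Complex.Gamma (s + n) * Complex.Gamma (s / 2 + (n : ℂ) / 2 + 1 / 2)) /
        (Complex.Gamma (s + n + 1) * Complex.Gamma (s / 2 + n + 1)) := by
  have hre : 0 < (s + n).re := by simp; linarith
  have h0 : s + n ≠ 0 := fun h => by simp [h] at hre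
  have hΓ : Complex.Gamma (s + n) ≠ 0 := Complex.Gamma_ne_zero_of_re_pos hre
  rw [integral_cpow_ballDistLaw hn hs, Complex.Gamma_add_one _ h0, add_comm (n : ℂ) s,
    add_comm ((n : ℂ) / 2) (s / 2), add_comm (n : ℂ) (s / 2)]
  field_simp

theorem two_cpow_mul_Gamma_mul_Gamma (s : ℂ) (n : ℕ) :
    (2 : ℂ) ^ s * Complex.Gamma (s / 2 + (n : ℂ) / 2 + 1 / 2) *
        Complex.Gamma (s / 2 + (n : ℂ) / 2 + 1) =
      ((√Real.pi * 2 ^ (-(n : ℝ)) : ℝ) : ℂ) * Complex.Gamma (s + n + 1) := by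
  have hduplication := Complex.Gamma_mul_Gamma_add_half (s / 2 + (n : ℂ) / 2 + 1 / 2)
  rw [show s / 2 + (n : ℂ) / 2 + 1 / 2 + 1 / 2 = s / 2 + (n : ℂ) / 2 + 1 by ring,
    show 2 * (s / 2 + (n : ℂ) / 2 + 1 / 2) = s + n + 1 by ring,
    show 1 - (s + n + 1) = -s + -(n : ℂ) by ring, Complex.cpow_add _ _ two_ne_zero] at hduplication
  have hcancel : (2 : ℂ) ^ s * (2 : ℂ) ^ (-s) = 1 := by
    rw [← Complex.cpow_add _ _ two_ne_zero, add_neg_cancel, Complex.cpow_zero]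
  rw [mul_assoc, hduplication, Complex.ofReal_mul, Complex.ofReal_cpow zero_le_two]
  push_cast
  linear_combination (Complex.Gamma (s + n + 1) * (2 : ℂ) ^ (-(n : ℂ)) * (√Real.pi : ℂ)) * hcancel

theorem two_cpow_mul_integral_cpow_ballDistLaw (hn : 1 ≤ n) (hs : -(n : ℝ) < s.re) :
    (2 : ℂ) ^ s * ∫ x : ℝ, (x : ℂ) ^ s ∂(ballDistLaw n) =
      ((√Real.pi * 2 ^ (-(n : ℝ)) * ballDistConst n : ℝ) : ℂ) * Complex.Gamma (s + n) /
        (Complex.Gamma (s / 2 + (n : ℂ) / 2 + 1) * Complex.Gamma (s / 2 + n + 1)) := by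
  have hΓ : Complex.Gamma (s + n + 1) ≠ 0 := Complex.Gamma_ne_zero_of_re_pos (by simp; linarith)
  have hΓ' : Complex.Gamma (s / 2 + (n : ℂ) / 2 + 1) ≠ 0 := by
    refine Complex.Gamma_ne_zero_of_re_pos ?_
    simp only [← add_div, Complex.add_re, Complex.div_ofNat_re, Complex.natCast_re, Complex.one_re]
    linarith
  rw [integral_cpow_ballDistLaw_eq_Gamma_mul_Gamma_div hn hs, mul_div_assoc', ← div_div, ← div_div]
  congr 1
  rw [div_eq_div_iff hΓ hΓ', Complex.ofReal_mul (_ * _)]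
  linear_combination (ballDistConst n * Complex.Gamma (s + n)) * two_cpow_mul_Gamma_mul_Gamma s n

end GammaForms

section NaturalMoments

theorem integral_pow_ballDistLaw {n : ℕ} (hn : 1 ≤ n) (k : ℕ) :
    ∫ x, x ^ k ∂(ballDistLaw n) = ballDistConst n * Real.Gamma ((n : ℝ) / 2 + k / 2 + 1 / 2) /
      ((n + k) * Real.Gamma ((n : ℝ) + k / 2 + 1)) := by
  have hn0 : (0 : ℝ) < n := by exact_mod_cast hn
  have h := integral_cpow_ballDistLaw hn (s := k)
    (by rw [Complex.natCast_re]; linarith [k.cast_nonneg (α := ℝ)])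
  simp only [Complex.cpow_natCast] at h
  rw [← Complex.ofReal_inj, ← integral_complex_ofReal]
  push_cast [← Complex.Gamma_ofReal] at h ⊢
  exact h

theorem integral_sq_ballDistLaw {n : ℕ} (hn : 1 ≤ n) :
    ∫ x, x ^ 2 ∂(ballDistLaw n) = n / (2 * (n + 2)) := by
  rw [integral_pow_ballDistLaw hn, ballDistConst, Nat.cast_two, div_self two_ne_zero,
    add_right_comm ((n : ℝ) / 2), Real.Gamma_add_one (s := (n : ℝ) / 2 + 1 / 2) (by positivity),
    Real.Gamma_add_one (s := (n : ℝ) + 1) (by positivity)]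
  field_simp

theorem integral_id_ballDistLaw {n : ℕ} (hn : 1 ≤ n) :
    ∫ x, x ∂(ballDistLaw n) = ballDistConst n * Real.Gamma ((n : ℝ) / 2 + 1) /
      ((n + 1) * Real.Gamma ((n : ℝ) + 1 + 1 / 2)) := by
  have h := integral_pow_ballDistLaw hn 1
  simpa only [pow_one, Nat.cast_one, add_assoc, add_halves, add_comm (1 / 2 : ℝ)] using h

theorem integral_id_ballDistLaw_one : ∫ x, x ∂(ballDistLaw 1) = 1 / 3 := by
  rw [integral_id_ballDistLaw le_rfl, ballDistConst, Nat.cast_one, add_halves, one_add_one_eq_two,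
    Real.Gamma_one, Real.Gamma_two, show (2 + 1 / 2 : ℝ) = 1 / 2 + 1 + 1 by norm_num,
    Real.Gamma_add_one (s := 1 / 2 + 1) (by norm_num)]
  field_simp
  norm_num

theorem integral_id_ballDistLaw_two : ∫ x, x ∂(ballDistLaw 2) = 64 / (45 * Real.pi) := by
  rw [integral_id_ballDistLaw one_le_two, ballDistConst, Nat.cast_two, div_self two_ne_zero,
    one_add_one_eq_two, Real.Gamma_two, show (2 + 1 : ℝ) = (2 : ℕ) + 1 by norm_num,
    Real.Gamma_nat_eq_factorial, show ((2 : ℕ) + 1 + 1 / 2 : ℝ) = 1 / 2 + 1 + 1 + 1 by norm_num,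
    add_comm (1 : ℝ) (1 / 2), Real.Gamma_add_one (s := 1 / 2 + 1 + 1) (by norm_num),
    Real.Gamma_add_one (s := 1 / 2 + 1) (by norm_num),
    Real.Gamma_add_one (s := 1 / 2) (by norm_num), Real.Gamma_one_half_eq]
  simp only [Nat.factorial]
  push_cast
  field_simp
  rw [Real.sq_sqrt Real.pi_pos.le]
  ring

theorem integral_id_ballDistLaw_three : ∫ x, x ∂(ballDistLaw 3) = 18 / 35 := by
  rw [integral_id_ballDistLaw (by norm_num), ballDistConst, Real.Gamma_nat_eq_factorial,
    Nat.cast_ofNat, show (3 / 2 + 1 / 2 : ℝ) = 2 by norm_num, Real.Gamma_two,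
    show (3 + 1 + 1 / 2 : ℝ) = 3 / 2 + 1 + 1 + 1 by norm_num,
    Real.Gamma_add_one (s := 3 / 2 + 1 + 1) (by norm_num),
    Real.Gamma_add_one (s := 3 / 2 + 1) (by norm_num)]
  simp only [Nat.factorial]
  push_cast
  field_simp
  norm_num

end NaturalMoments

section Scaling

variable {Ω : Type*} [MeasurableSpace Ω] {P : Measure Ω} {D : Ω → ℝ} {b : ℝ} {μ : Measure ℝ}

theorem ofReal_cpow_eq_cpow_mul_div_cpow (hb : 0 < b) (x : ℝ) (s : ℂ) :
    (x : ℂ) ^ s = (b : ℂ) ^ s * ((x / b : ℝ) : ℂ) ^ s := by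
  have hb0 : (b : ℂ) ≠ 0 := Complex.ofReal_ne_zero.2 hb.ne'
  obtain rfl | hx := eq_or_ne x 0
  · obtain rfl | hs := eq_or_ne s 0
    · simp only [Complex.cpow_zero, mul_one]
    · simp only [zero_div, Complex.ofReal_zero, Complex.zero_cpow hs, mul_zero]
  · have hxb : ((x / b : ℝ) : ℂ) ≠ 0 := Complex.ofReal_ne_zero.2 (div_ne_zero hx hb.ne')
    have hlog : Complex.log x = Complex.log b + Complex.log (x / b : ℝ) := by
      rw [← Complex.ofReal_log hb.le, ← Complex.log_ofReal_mul hb hxb, ← Complex.ofReal_mul,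
        mul_div_cancel₀ _ hb.ne']
    rw [Complex.cpow_def_of_ne_zero (Complex.ofReal_ne_zero.2 hx), hlog, add_mul, Complex.exp_add,
      ← Complex.cpow_def_of_ne_zero hb0, ← Complex.cpow_def_of_ne_zero hxb]

theorem integrable_cpow_iff_of_hasLaw_div (hb : 0 < b) (hD : HasLaw (fun ω => D ω / b) μ P)
    (s : ℂ) :
    Integrable (fun ω => (D ω : ℂ) ^ s) P ↔ Integrable (fun x : ℝ => (x : ℂ) ^ s) μ := by
  have hcpow : Measurable fun x : ℝ => (x : ℂ) ^ s := by fun_prop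
  have hunit : IsUnit ((b : ℂ) ^ s) :=
    (Complex.cpow_ne_zero_iff.2 (Or.inl (Complex.ofReal_ne_zero.2 hb.ne'))).isUnit
  simp only [ofReal_cpow_eq_cpow_mul_div_cpow hb (D _)]
  rw [integrable_const_mul_iff hunit, ← hD.map_eq,
    integrable_map_measure hcpow.aestronglyMeasurable hD.aemeasurable]
  rfl

theorem integral_cpow_div_of_hasLaw_div (hD : HasLaw (fun ω => D ω / b) μ P) (s : ℂ) :
    ∫ ω, ((D ω / b : ℝ) : ℂ) ^ s ∂P = ∫ x : ℝ, (x : ℂ) ^ s ∂μ :=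
  hD.integral_comp (f := fun x : ℝ => (x : ℂ) ^ s) (Measurable.aestronglyMeasurable (by fun_prop))

theorem integral_cpow_of_hasLaw_div (hb : 0 < b) (hD : HasLaw (fun ω => D ω / b) μ P) (s : ℂ) :
    ∫ ω, (D ω : ℂ) ^ s ∂P = (b : ℂ) ^ s * ∫ x : ℝ, (x : ℂ) ^ s ∂μ := by
  rw [← integral_cpow_div_of_hasLaw_div hD, ← integral_const_mul]
  simp only [← ofReal_cpow_eq_cpow_mul_div_cpow hb (D _)]

theorem integral_pow_of_hasLaw_div (hb : b ≠ 0) (hD : HasLaw (fun ω => D ω / b) μ P) (k : ℕ) :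
    ∫ ω, D ω ^ k ∂P = b ^ k * ∫ x, x ^ k ∂μ := by
  rw [← hD.integral_comp (by fun_prop), ← integral_const_mul]
  simp only [Function.comp_apply, ← mul_pow, mul_div_cancel₀ _ hb]

theorem integral_of_hasLaw_div (hb : b ≠ 0) (hD : HasLaw (fun ω => D ω / b) μ P) :
    ∫ ω, D ω ∂P = b * ∫ x, x ∂μ := by
  simpa only [pow_one] using integral_pow_of_hasLaw_div hb hD 1

theorem identDistrib_const_mul_of_hasLaw_div {Ω' : Type*} [MeasurableSpace Ω'] {Q : Measure Ω'}
    {B : Ω' → ℝ} (hb : b ≠ 0) (hD : HasLaw (fun ω => D ω / b) μ P) (hB : HasLaw B μ Q) :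
    IdentDistrib D (fun ω => b * B ω) P Q := by
  simpa only [mul_div_cancel₀ _ hb] using (hD.identDistrib hB).const_mul b

theorem integral_cpow_eq_of_hasLaw_div_ballDistLaw {n : ℕ} {s : ℂ} (hn : 1 ≤ n) (hb : 0 < b)
    (hD : HasLaw (fun ω => D ω / b) (ballDistLaw n) P) (hs : -(n : ℝ) < s.re) :
    ∫ ω, (D ω : ℂ) ^ s ∂P = (ballDistConst n : ℂ) * (b : ℂ) ^ s *
      (Complex.Gamma (s + n) * Complex.Gamma (s / 2 + (n : ℂ) / 2 + 1 / 2)) /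
        (Complex.Gamma (s + n + 1) * Complex.Gamma (s / 2 + n + 1)) := by
  rw [integral_cpow_of_hasLaw_div hb hD, integral_cpow_ballDistLaw_eq_Gamma_mul_Gamma_div hn hs]
  ring

theorem integral_cpow_eq_of_hasLaw_div_two_mul_ballDistLaw {n : ℕ} {s : ℂ} (hn : 1 ≤ n)
    (hb : 0 < b) (hD : HasLaw (fun ω => D ω / (2 * b)) (ballDistLaw n) P)
    (hs : -(n : ℝ) < s.re) :
    ∫ ω, (D ω : ℂ) ^ s ∂P =
      ((√Real.pi * 2 ^ (-(n : ℝ)) * ballDistConst n : ℝ) : ℂ) * (b : ℂ) ^ s *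
        Complex.Gamma (s + n) /
        (Complex.Gamma (s / 2 + (n : ℂ) / 2 + 1) * Complex.Gamma (s / 2 + n + 1)) := by
  have hmoment := two_cpow_mul_integral_cpow_ballDistLaw hn hs
  rw [integral_cpow_of_hasLaw_div (by positivity) hD, Complex.ofReal_mul,
    Complex.mul_cpow_ofReal_nonneg zero_le_two hb.le, Complex.ofReal_ofNat, mul_right_comm, hmoment]
  ring

theorem integral_sq_of_hasLaw_div_two_mul_ballDistLaw {n : ℕ} (hn : 1 ≤ n) (hb : b ≠ 0)
    (hD : HasLaw (fun ω => D ω / (2 * b)) (ballDistLaw n) P) :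
    ∫ ω, D ω ^ 2 ∂P = 2 * b ^ 2 * n / (n + 2) := by
  rw [integral_pow_of_hasLaw_div (mul_ne_zero two_ne_zero hb) hD, integral_sq_ballDistLaw hn]
  field_simp

end Scaling

section Factorisation

variable {Ω : Type*} [MeasurableSpace Ω] {Q : Measure Ω} {n : ℕ}

theorem hasLaw_mul_sqrt_ballDistLaw (hn : 1 ≤ n) {B₁ B₂ : Ω → ℝ}
    (h₁ : HasLaw B₁ (betaMeasure n 1) Q)
    (h₂ : HasLaw B₂ (betaMeasure (((n : ℝ) + 1) / 2) (((n : ℝ) + 1) / 2)) Q)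
    (hind : IndepFun B₁ B₂ Q) : HasLaw (fun ω => B₁ ω * B₂ ω ^ (1 / 2 : ℝ)) (ballDistLaw n) Q := by
  have hγ : 0 < ((n : ℝ) + 1) / 2 := by positivity
  have := isProbabilityMeasureBeta (α := (n : ℝ)) (by positivity) one_pos
  have := isProbabilityMeasure_map_rpow_betaMeasure hγ hγ (1 / 2)
  have hsqrt : Measurable fun x : ℝ => x ^ (1 / 2 : ℝ) := by fun_prop
  exact IndepFun.hasLaw_fun_mul h₁ (HasLaw.fun_comp ⟨hsqrt.aemeasurable, rfl⟩ h₂)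
    (hind.comp measurable_id hsqrt)

theorem hasLaw_rpow_one_div_of_isUniform {α : ℝ} (hα : 0 < α) {U : Ω → ℝ}
    (hU : pdf.IsUniform U (Set.Ioo (0 : ℝ) 1) Q volume) :
    HasLaw (fun ω => U ω ^ (1 / α)) (betaMeasure α 1) Q := by
  have hlaw : HasLaw U (volume.restrict (Set.Ioo (0 : ℝ) 1)) Q :=
    ⟨hU.aemeasurable (by simp) (by simp), by rw [hU, ProbabilityTheory.cond]; simp⟩
  exact HasLaw.fun_comp ⟨by fun_prop, map_rpow_one_div_uniform hα⟩ hlaw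

theorem hasLaw_rpow_mul_sqrt_ballDistLaw (hn : 1 ≤ n) {U B₂ : Ω → ℝ}
    (hU : pdf.IsUniform U (Set.Ioo (0 : ℝ) 1) Q volume)
    (h₂ : HasLaw B₂ (betaMeasure (((n : ℝ) + 1) / 2) (((n : ℝ) + 1) / 2)) Q)
    (hind : IndepFun U B₂ Q) :
    HasLaw (fun ω => U ω ^ (1 / (n : ℝ)) * B₂ ω ^ (1 / 2 : ℝ)) (ballDistLaw n) Q :=
  hasLaw_mul_sqrt_ballDistLaw hn (hasLaw_rpow_one_div_of_isUniform (by positivity) hU) h₂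
    (hind.comp (φ := fun u => u ^ (1 / (n : ℝ))) (by fun_prop) measurable_id)

end Factorisation

section BallDistance

variable {E : Type*} [NormedAddCommGroup E] [InnerProductSpace ℝ E] [FiniteDimensional ℝ E]
  [MeasurableSpace E] [BorelSpace E]

theorem mainTheorem6_general {Ω : Type*} [MeasurableSpace Ω] (P : Measure Ω)
    [IsProbabilityMeasure P] (n : ℕ) (hE : Module.finrank ℝ E = n) (hn : 1 ≤ n) (a : ℝ)
    (ha : 0 < a) (c : E) (X₁ X₂ : Ω → E)
    (hX₁ : pdf.IsUniform X₁ (Metric.closedBall c a) P volume)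
    (hX₂ : pdf.IsUniform X₂ (Metric.closedBall c a) P volume)
    (hind : IndepFun X₁ X₂ P)
    (D : Ω → ℝ) (hD : ∀ ω, D ω = dist (X₁ ω) (X₂ ω)) :
    HasLaw (fun ω => D ω / (2 * a))
      ((volume.restrict (Set.Ioo (0 : ℝ) 1)).withDensity
        (fun l => ENNReal.ofReal (ballDistDensity n l))) P ∧
    (∀ s : ℂ, Integrable (fun ω => (D ω : ℂ) ^ s) P ↔ -(n : ℝ) < s.re) ∧
    (∀ s : ℂ, -(n : ℝ) < s.re →
      ∫ ω, ((D ω / (2 * a) : ℝ) : ℂ) ^ s ∂P =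
        (ballDistConst n : ℂ) * Complex.Gamma ((n : ℂ) / 2 + s / 2 + 1 / 2) /
          (((n : ℂ) + s) * Complex.Gamma ((n : ℂ) + s / 2 + 1)) ∧
      ∫ ω, (D ω : ℂ) ^ s ∂P =
        (ballDistConst n : ℂ) * ((2 * a : ℝ) : ℂ) ^ s *
          (Complex.Gamma (s + n) * Complex.Gamma (s / 2 + (n : ℂ) / 2 + 1 / 2)) /
          (Complex.Gamma (s + n + 1) * Complex.Gamma (s / 2 + n + 1)) ∧
      ∫ ω, (D ω : ℂ) ^ s ∂P =
        ((Real.sqrt Real.pi * 2 ^ (-(n : ℝ)) * ballDistConst n : ℝ) : ℂ) * (a : ℂ) ^ s *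
          Complex.Gamma (s + n) /
          (Complex.Gamma (s / 2 + (n : ℂ) / 2 + 1) * Complex.Gamma (s / 2 + n + 1))) ∧
    (∀ {Ω' : Type*} [MeasurableSpace Ω'] (Q : Measure Ω') (B₁ B₂ : Ω' → ℝ),
      HasLaw B₁ (betaMeasure n 1) Q →
      HasLaw B₂ (betaMeasure (((n : ℝ) + 1) / 2) (((n : ℝ) + 1) / 2)) Q →
      IndepFun B₁ B₂ Q →
      IdentDistrib D (fun ω => 2 * a * B₁ ω * B₂ ω ^ (1 / 2 : ℝ)) P Q) ∧
    (∀ {Ω' : Type*} [MeasurableSpace Ω'] (Q : Measure Ω') (U B₂ : Ω' → ℝ),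
      pdf.IsUniform U (Set.Ioo (0 : ℝ) 1) Q volume →
      HasLaw B₂ (betaMeasure (((n : ℝ) + 1) / 2) (((n : ℝ) + 1) / 2)) Q →
      IndepFun U B₂ Q →
      IdentDistrib D (fun ω => 2 * a * U ω ^ (1 / (n : ℝ)) * B₂ ω ^ (1 / 2 : ℝ)) P Q) ∧
    (n = 2 → ∫ ω, D ω ∂P = 128 / (45 * Real.pi) * a) ∧
    (n = 1 → a = 1 / 2 → ∫ ω, D ω ∂P = 1 / 3 ∧ ∫ ω, D ω ^ 2 ∂P = 1 / 6) ∧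
    (n = 2 → a = 1 / 2 → ∫ ω, D ω ∂P = 64 / (45 * Real.pi) ∧ ∫ ω, D ω ^ 2 ∂P = 1 / 4) ∧
    (n = 3 → a = 1 / 2 → ∫ ω, D ω ∂P = 18 / 35 ∧ ∫ ω, D ω ^ 2 ∂P = 3 / 10) ∧
    ∫ ω, D ω ^ 2 ∂P = 2 * a ^ 2 * n / (n + 2) := by
  have h2a : 0 < 2 * a := by positivity
  have hlaw : HasLaw (fun ω => D ω / (2 * a)) (ballDistLaw n) P := by
    simpa only [hD] using hasLaw_dist_div_ballDistLaw hE hn ha hX₁ hX₂ hind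
  have hmean := integral_of_hasLaw_div h2a.ne' hlaw
  have hsq := integral_sq_of_hasLaw_div_two_mul_ballDistLaw hn ha.ne' hlaw
  refine ⟨ballDistLaw_eq_withDensity hn ▸ hlaw, fun s => ?_, fun s hs => ⟨?_, ?_, ?_⟩,
    fun Q B₁ B₂ h₁ h₂ hind => ?_, fun Q U B₂ hU h₂ hind => ?_, ?_, ?_, ?_, ?_, hsq⟩
  · exact (integrable_cpow_iff_of_hasLaw_div h2a hlaw s).trans (integrable_cpow_ballDistLaw_iff hn)
  · exact (integral_cpow_div_of_hasLaw_div hlaw s).trans (integral_cpow_ballDistLaw hn hs)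
  · exact integral_cpow_eq_of_hasLaw_div_ballDistLaw hn h2a hlaw hs
  · exact integral_cpow_eq_of_hasLaw_div_two_mul_ballDistLaw hn ha hlaw hs
  · simpa only [mul_assoc] using
      identDistrib_const_mul_of_hasLaw_div h2a.ne' hlaw (hasLaw_mul_sqrt_ballDistLaw hn h₁ h₂ hind)
  · simpa only [mul_assoc] using identDistrib_const_mul_of_hasLaw_div h2a.ne' hlaw
      (hasLaw_rpow_mul_sqrt_ballDistLaw hn hU h₂ hind)
  · rintro rfl
    rw [hmean, integral_id_ballDistLaw_two]
    ring
  · rintro rfl rfl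
    norm_num [hmean, hsq, integral_id_ballDistLaw_one]
  · rintro rfl rfl
    norm_num [hmean, hsq, integral_id_ballDistLaw_two]
  · rintro rfl rfl
    norm_num [hmean, hsq, integral_id_ballDistLaw_three]

end BallDistance

theorem mainTheorem6 {Ω : Type*} [MeasurableSpace Ω] (P : Measure Ω) [IsProbabilityMeasure P]
    (n : ℕ) (hn : 1 ≤ n) (a : ℝ) (ha : 0 < a) (c : EuclideanSpace ℝ (Fin n))
    (X₁ X₂ : Ω → EuclideanSpace ℝ (Fin n))
    (hX₁ : pdf.IsUniform X₁ (Metric.closedBall c a) P volume)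
    (hX₂ : pdf.IsUniform X₂ (Metric.closedBall c a) P volume)
    (hind : IndepFun X₁ X₂ P)
    (D : Ω → ℝ) (hD : ∀ ω, D ω = dist (X₁ ω) (X₂ ω)) :
    -- the density of `D / (2a)`
    HasLaw (fun ω => D ω / (2 * a))
      ((volume.restrict (Set.Ioo (0 : ℝ) 1)).withDensity
        (fun l => ENNReal.ofReal (ballDistDensity n l))) P ∧
    -- the moment of order `s` exists exactly for `Re s > -n`
    (∀ s : ℂ, Integrable (fun ω => (D ω : ℂ) ^ s) P ↔ -(n : ℝ) < s.re) ∧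
    -- the moments
    (∀ s : ℂ, -(n : ℝ) < s.re →
      ∫ ω, ((D ω / (2 * a) : ℝ) : ℂ) ^ s ∂P =
        (ballDistConst n : ℂ) * Complex.Gamma ((n : ℂ) / 2 + s / 2 + 1 / 2) /
          (((n : ℂ) + s) * Complex.Gamma ((n : ℂ) + s / 2 + 1)) ∧
      ∫ ω, (D ω : ℂ) ^ s ∂P =
        (ballDistConst n : ℂ) * ((2 * a : ℝ) : ℂ) ^ s *
          (Complex.Gamma (s + n) * Complex.Gamma (s / 2 + (n : ℂ) / 2 + 1 / 2)) /
          (Complex.Gamma (s + n + 1) * Complex.Gamma (s / 2 + n + 1)) ∧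
      ∫ ω, (D ω : ℂ) ^ s ∂P =
        ((Real.sqrt Real.pi * 2 ^ (-(n : ℝ)) * ballDistConst n : ℝ) : ℂ) * (a : ℂ) ^ s *
          Complex.Gamma (s + n) /
          (Complex.Gamma (s / 2 + (n : ℂ) / 2 + 1) * Complex.Gamma (s / 2 + n + 1))) ∧
    -- the factorisation with independent Beta variables
    (∀ {Ω' : Type*} [MeasurableSpace Ω'] (Q : Measure Ω') [IsProbabilityMeasure Q]
      (B₁ B₂ : Ω' → ℝ),
      HasLaw B₁ (betaMeasure n 1) Q →
      HasLaw B₂ (betaMeasure (((n : ℝ) + 1) / 2) (((n : ℝ) + 1) / 2)) Q →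
      IndepFun B₁ B₂ Q →
      IdentDistrib D (fun ω => 2 * a * B₁ ω * B₂ ω ^ (1 / 2 : ℝ)) P Q) ∧
    -- the same with a uniform variable in place of the first Beta variable
    (∀ {Ω' : Type*} [MeasurableSpace Ω'] (Q : Measure Ω') [IsProbabilityMeasure Q]
      (U B₂ : Ω' → ℝ),
      pdf.IsUniform U (Set.Ioo (0 : ℝ) 1) Q volume →
      HasLaw B₂ (betaMeasure (((n : ℝ) + 1) / 2) (((n : ℝ) + 1) / 2)) Q →
      IndepFun U B₂ Q →
      IdentDistrib D (fun ω => 2 * a * U ω ^ (1 / (n : ℝ)) * B₂ ω ^ (1 / 2 : ℝ)) P Q) ∧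
    -- special cases
    (n = 2 → ∫ ω, D ω ∂P = 128 / (45 * Real.pi) * a) ∧
    (n = 1 → a = 1 / 2 → ∫ ω, D ω ∂P = 1 / 3 ∧ ∫ ω, D ω ^ 2 ∂P = 1 / 6) ∧
    (n = 2 → a = 1 / 2 → ∫ ω, D ω ∂P = 64 / (45 * Real.pi) ∧ ∫ ω, D ω ^ 2 ∂P = 1 / 4) ∧
    (n = 3 → a = 1 / 2 → ∫ ω, D ω ∂P = 18 / 35 ∧ ∫ ω, D ω ^ 2 ∂P = 3 / 10) ∧
    ∫ ω, D ω ^ 2 ∂P = 2 * a ^ 2 * n / (n + 2) := by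
  obtain ⟨hlaw, hint, hmoments, hbeta, hunif, hvalues⟩ :=
    mainTheorem6_general P n finrank_euclideanSpace_fin hn a ha c X₁ X₂ hX₁ hX₂ hind D hD
  exact ⟨hlaw, hint, hmoments, fun Q _ => hbeta Q, fun Q _ => hunif Q, hvalues⟩
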